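/- Let $K$ be a field, $R=K[x_1,\ldots,x_n]$, let $\prec$ be an admissible monomial ordering, and write $lm$, $lc$, $lt$ for leading monomial, coefficient and term; for nonzero $f,f'$, $lcm(f,f')$ denotes the least common multiple of $lm(f)$ and $lm(f')$. An involutive division $L$ assigns to every finite set $U$ of monomials a relation $u|_L w$ (w.r.t. $U$), $u\in U$, $w$ a monomial, such that for all $u,u_1\in U$ and monomials $v,w$: (i) $u|_L w$ implies $u|w$; (ii) $u|_L u$; (iii) $u|_L(uv)$ and $u|_L(uw)$ hold if and only if $u|_L(uvw)$; (iv) if $u|_Lw$ and $u_1|_Lw$, then $u|_Lu_1$ or $u_1|_Lu$; (v) if $u|_Lu_1$ and $u_1|_Lw$, then $u|_Lw$; (vi) if $V\subseteq U$ and $u\in V$, then $u|_Lw$ w.r.t. $U$ implies $u|_Lw$ w.r.t. $V$. Let $F\subset R\setminus\{0\}$ be a finite set, and take $|_L$ w.r.t. $lm(F)=\{lm(f): f\in F\}$. An $L$-reduction modulo $F$ replaces a polynomial $p$ having a term $a\,lm(f)v$, with $a\ne0$, $f\in F$, $v$ a monomial and $lm(f)|_L\,lm(f)v$, by $p-\frac{a}{lc(f)}fv$.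 An $L$-normal form of $p$ is an $L$-irreducible polynomial obtained from $p$ by finitely many $L$-reductions; $NF_L(p,F)=0$ means that $0$ is an $L$-normal form of $p$ modulo $F$ and is the only one. The set $F$ is $L$-autoreduced if no element of $lm(F)$ is involutively divisible by another element of $lm(F)$, and no monomial different from $lm(f)$ that occurs in some $f\in F$ has an involutive divisor in $lm(F)$. Theorem. Let $F\subset R\setminus\{0\}$ be a finite $L$-autoreduced set, let $g\in F$, and let $x$ be a variable that is non-multiplicative for $g$, i.e. $lm(g)|_L\,lm(g)x$ does not hold. Assume: (1) for all $h\in F$ and all monomials $u$ with $lm(h)u\prec lm(g)x$ one has $NF_L(hu,F)=0$; (2) there are $f,f_0,g_0\in F$ such that $lm(f_0)|lm(f)$, $lm(g_0)|lm(g)$, $lm(f)|_L\,lm(g)x$, $lcm(f_0,g_0)\prec lm(g)x$, and $$NF_L\Bigl(f_0\,\frac{lt(f)}{lt(f_0)},F\Bigr)=NF_L\Bigl(g_0\,\frac{lt(g)}{lt(g_0)},F\Bigr)=0 .$$ Then $NF_L(gx,F)=0$. -/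

import Mathlib

open scoped MonomialOrder

/-- An involutive monomial division on the monomials in `n` variables. The monomial
`x_1^{d_1} ⋯ x_n^{d_n}` is its exponent vector `d : Fin n →₀ ℕ`, so that products of monomials
are sums and ordinary divisibility is `≤`. For a finite set `U` of monomials and `u ∈ U`,
`dvd U u w` says that `u` is an involutive divisor of `w` with respect to `U`. -/
structure InvolutiveDivision (n : ℕ) where
  /-- The relation `u |_L w` with respect to the finite set `U` (relevant for `u ∈ U`). -/
  dvd : Finset (Fin n →₀ ℕ) → (Fin n →₀ ℕ) → (Fin n →₀ ℕ) → Prop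
  le_of_dvd : ∀ U, ∀ u ∈ U, ∀ w, dvd U u w → u ≤ w
  dvd_self : ∀ U, ∀ u ∈ U, dvd U u u
  dvd_add_and_iff : ∀ U, ∀ u ∈ U, ∀ v w,
    (dvd U u (u + v) ∧ dvd U u (u + w)) ↔ dvd U u (u + v + w)
  dvd_or_dvd : ∀ U, ∀ u ∈ U, ∀ u₁ ∈ U, ∀ w,
    dvd U u w → dvd U u₁ w → dvd U u u₁ ∨ dvd U u₁ u
  dvd_trans : ∀ U, ∀ u ∈ U, ∀ u₁ ∈ U, ∀ w, dvd U u u₁ → dvd U u₁ w → dvd U u w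
  dvd_of_subset : ∀ U V, V ⊆ U → ∀ u ∈ V, ∀ w, dvd U u w → dvd V u w

namespace InvolutiveDivision

variable {n : ℕ} {K : Type*} [Field K]

/-- The variable `x_i` is multiplicative for `u ∈ U`. -/
def IsMultiplicative (L : InvolutiveDivision n) (U : Finset (Fin n →₀ ℕ)) (u : Fin n →₀ ℕ)
    (i : Fin n) : Prop :=
  L.dvd U u (u + Finsupp.single i 1)

/-- The involutive cone `C_L(U)`: all monomials with an involutive divisor in `U`. -/
def cone (L : InvolutiveDivision n) (U : Finset (Fin n →₀ ℕ)) : Set (Fin n →₀ ℕ) :=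
  {w | ∃ u ∈ U, L.dvd U u w}

/-- No element of the monomial set `U` is involutively divisible by another one. -/
def AutoreducedMonomials (L : InvolutiveDivision n) (U : Finset (Fin n →₀ ℕ)) : Prop :=
  ∀ u ∈ U, ∀ v ∈ U, L.dvd U u v → u = v

/-- The set `lm(F)` of the leading monomials of a finite polynomial set. -/
noncomputable def leadingMonomials (m : MonomialOrder (Fin n))
    (F : Finset (MvPolynomial (Fin n) K)) : Finset (Fin n →₀ ℕ) :=
  F.image m.degree

/-- `F` is `L`-autoreduced: `lm(F)` is, and no non-leading monomial occurring in an element of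
`F` lies in the involutive cone of `lm(F)`. -/
def Autoreduced (L : InvolutiveDivision n) (m : MonomialOrder (Fin n))
    (F : Finset (MvPolynomial (Fin n) K)) : Prop :=
  L.AutoreducedMonomials (leadingMonomials m F) ∧
    ∀ f ∈ F, ∀ u ∈ f.support, u ≠ m.degree f → u ∉ L.cone (leadingMonomials m F)

/-- One `L`-reduction step modulo `F`: `p` has a term `a·u`, `a ≠ 0`, with `u = lm(f) × v` for
some `f ∈ F` and `v` multiplicative for `lm(f)`, and `q = p - (a / lc(f)) f v`. -/
def Reduces (L : InvolutiveDivision n) (m : MonomialOrder (Fin n))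
    (F : Finset (MvPolynomial (Fin n) K)) (p q : MvPolynomial (Fin n) K) : Prop :=
  ∃ f ∈ F, ∃ v : Fin n →₀ ℕ,
    p.coeff (m.degree f + v) ≠ 0 ∧
    L.dvd (leadingMonomials m F) (m.degree f) (m.degree f + v) ∧
    q = p - MvPolynomial.monomial v (p.coeff (m.degree f + v) / m.leadingCoeff f) * f

/-- `h` is an `L`-normal form of `p` modulo `F`: it is obtained from `p` by finitely many
`L`-reductions and is itself not `L`-reducible. -/
def IsNormalForm (L : InvolutiveDivision n) (m : MonomialOrder (Fin n))
    (F : Finset (MvPolynomial (Fin n) K)) (p h : MvPolynomial (Fin n) K) : Prop :=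
  Relation.ReflTransGen (L.Reduces m F) p h ∧ ∀ q, ¬ L.Reduces m F h q

/-- `NF_L(p, F) = h`: the polynomial `h` is an `L`-normal form of `p` modulo `F`, and it is the
only one, so that every choice of reductions leads from `p` to `h`. -/
def NormalFormEq (L : InvolutiveDivision n) (m : MonomialOrder (Fin n))
    (F : Finset (MvPolynomial (Fin n) K)) (p h : MvPolynomial (Fin n) K) : Prop :=
  L.IsNormalForm m F p h ∧ ∀ h', L.IsNormalForm m F p h' → h' = h

end InvolutiveDivision

/-!
Write `w = lm(g) x_i`. For a lower set `P` of monomials let `V(P)` be the span of the multiplicative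
products `h x^v` (those with `lm(h) |_L lm(h) x^v`) whose leading monomial lies in `P`. If `p` has
normal form zero, its reduction chain writes it as an element of `V({u ≼ lm(p)})`. Conversely,
every `p ∈ V(P)` with `lm(p) ∈ P` has normal form zero as the only one
(`normalFormEq_zero_of_mem_multiplicativeSpan`): reductions stay in `V(P)`, and a nonzero element
of `V(P)` has its leading monomial in the involutive cone
(`degree_mem_cone_of_mem_multiplicativeSpan`), because an involutive divisor in `lm(F)` is unique
and so distinct multiplicative products have distinct leading monomials.

Uniqueness of the divisor concerns only leading monomials, and several elements of `F` may share
one. The criterion needs such elements to be proportional (`ProportionalOn`). Below `w` this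
follows from the normal forms of the elements of `F` themselves; at `w` it follows from the normal
form of `f₀ lt(f)/lt(f₀)`.

It remains to show `g x_i ∈ V({u ≼ w})`. Let `f x^v` have leading monomial `w`. All products below
`w` lie in `V({u ≺ w})` by the first assumption, so it suffices to identify the monic multiples of
`g` and `f` with leading monomial `w` modulo such products. Each normal form hypothesis, with its
head removed (`NormalFormEq.sub_mem_of_head`), gives one link: those for `lt(f)` and `lt(g)` link
`f` with `f₀` and `g` with `g₀`; and the multiples of `f₀` and `g₀` with leading monomial
`d = lcm(f₀, g₀) ≺ w` both have the head of the same multiplicative product `h x^z`, so after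
multiplication by `w / d` they link `f₀` with `g₀` through `h`.
-/

namespace InvolutiveDivision

section Auxiliary

open MvPolynomial

variable {n : ℕ} {K : Type*} [Field K] {L : InvolutiveDivision n} {m : MonomialOrder (Fin n)}
  {F : Finset (MvPolynomial (Fin n) K)}

/-! ### Spans of products and leading monomials -/

/-- The span of the products `h * x^u`, `h ∈ F`, whose leading monomial lies in `P`. -/
noncomputable def productSpan (m : MonomialOrder (Fin n)) (F : Finset (MvPolynomial (Fin n) K))
    (P : Set (Fin n →₀ ℕ)) : Submodule K (MvPolynomial (Fin n) K) :=
  Submodule.span K {p | ∃ h ∈ F, ∃ u, m.degree h + u ∈ P ∧ p = monomial u 1 * h}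

/-- The span of the products `h * x^v`, `h ∈ F`, with `lm(h) |_L lm(h) * x^v`, whose leading
monomial lies in `P`. -/
noncomputable def multiplicativeSpan (L : InvolutiveDivision n) (m : MonomialOrder (Fin n))
    (F : Finset (MvPolynomial (Fin n) K)) (P : Set (Fin n →₀ ℕ)) :
    Submodule K (MvPolynomial (Fin n) K) :=
  Submodule.span K {p | ∃ h ∈ F, ∃ v, L.dvd (leadingMonomials m F) (m.degree h) (m.degree h + v) ∧
    m.degree h + v ∈ P ∧ p = monomial v 1 * h}

/-- Any two elements of `F` with the same leading monomial, this lying in `P`, are scalar multiples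
of each other. An autoreduced `F` may contain several polynomials with one leading monomial. -/
def ProportionalOn (m : MonomialOrder (Fin n)) (F : Finset (MvPolynomial (Fin n) K))
    (P : Set (Fin n →₀ ℕ)) : Prop :=
  ∀ h ∈ F, ∀ h' ∈ F, m.degree h = m.degree h' → m.degree h ∈ P →
    m.leadingCoeff h' • h = m.leadingCoeff h • h'

lemma degree_mem_leadingMonomials {f : MvPolynomial (Fin n) K} (hf : f ∈ F) :
    m.degree f ∈ leadingMonomials m F :=
  Finset.mem_image_of_mem _ hf

lemma leadingCoeff_ne_zero_of_mem (hF0 : 0 ∉ F) {f : MvPolynomial (Fin n) K} (hf : f ∈ F) :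
    m.leadingCoeff f ≠ 0 :=
  m.leadingCoeff_ne_zero_iff.2 fun h => hF0 (h ▸ hf)

lemma monomial_mul_eq_smul (v : Fin n →₀ ℕ) (c : K) (h : MvPolynomial (Fin n) K) :
    monomial v c * h = c • (monomial v 1 * h) := by
  rw [← smul_mul_assoc, smul_monomial, smul_eq_mul, mul_one]

lemma coeff_monomial_mul_degree (v : Fin n →₀ ℕ) (c : K) (h : MvPolynomial (Fin n) K) :
    (monomial v c * h).coeff (m.degree h + v) = c * m.leadingCoeff h := by
  rw [add_comm, coeff_monomial_mul]; rfl

lemma coeff_monomial_mul_of_lt {v u : Fin n →₀ ℕ} (c : K) {h : MvPolynomial (Fin n) K}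
    (hu : m.degree h + v ≺[m] u) : (monomial v c * h).coeff u = 0 := by
  rw [coeff_monomial_mul']
  split_ifs with hvu
  · rw [m.coeff_eq_zero_of_lt, mul_zero]
    have h1 : u - v + v = u := tsub_add_cancel_of_le hvu
    rw [← h1, map_add, map_add] at hu
    exact lt_of_add_lt_add_right hu
  · rfl

lemma degree_eq_of_coeff {p : MvPolynomial (Fin n) K} {u : Fin n →₀ ℕ} (hu : p.coeff u ≠ 0)
    (hlt : ∀ u', u ≺[m] u' → p.coeff u' = 0) : m.degree p = u := by
  apply m.toSyn.injective
  apply le_antisymm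
  · rw [m.degree_le_iff]
    intro b hb
    by_contra hcon
    exact (mem_support_iff.1 hb) (hlt b (not_le.1 hcon))
  · exact m.le_degree (mem_support_iff.2 hu)

lemma degree_monomial_mul (hF0 : 0 ∉ F) {h : MvPolynomial (Fin n) K} (hh : h ∈ F)
    (v : Fin n →₀ ℕ) {c : K} (hc : c ≠ 0) : m.degree (monomial v c * h) = m.degree h + v := by
  apply degree_eq_of_coeff
  · rw [coeff_monomial_mul_degree]
    exact mul_ne_zero hc (leadingCoeff_ne_zero_of_mem hF0 hh)
  · exact fun u' hu' => coeff_monomial_mul_of_lt c hu'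

/-! ### Cones and involutive divisors -/

lemma exists_mem_of_mem_cone {u : Fin n →₀ ℕ} (hu : u ∈ L.cone (leadingMonomials m F)) :
    ∃ f ∈ F, ∃ v, m.degree f + v = u ∧
      L.dvd (leadingMonomials m F) (m.degree f) (m.degree f + v) := by
  obtain ⟨d, hd, hdu⟩ := hu
  obtain ⟨f, hf, rfl⟩ := Finset.mem_image.1 hd
  have h1 := add_tsub_cancel_of_le (L.le_of_dvd _ _ hd _ hdu)
  exact ⟨f, hf, u - m.degree f, h1, by rwa [h1]⟩

lemma degree_eq_of_dvd (hF : L.Autoreduced m F) {f h : MvPolynomial (Fin n) K} (hf : f ∈ F)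
    (hh : h ∈ F) {w : Fin n →₀ ℕ} (hfw : L.dvd (leadingMonomials m F) (m.degree f) w)
    (hhw : L.dvd (leadingMonomials m F) (m.degree h) w) : m.degree f = m.degree h := by
  have hf' := degree_mem_leadingMonomials (m := m) hf
  have hh' := degree_mem_leadingMonomials (m := m) hh
  rcases L.dvd_or_dvd _ _ hf' _ hh' _ hfw hhw with h1 | h1
  · exact hF.1 _ hf' _ hh' h1
  · exact (hF.1 _ hh' _ hf' h1).symm

/-- If the leading terms of two elements of `F` cancel, only tails remain, and these
avoid the involutive cone. -/
lemma notMem_cone_of_cancel (hF : L.Autoreduced m F) {h h' : MvPolynomial (Fin n) K} (hh : h ∈ F)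
    (hh' : h' ∈ F) (hdeg : m.degree h = m.degree h') {a b : K}
    (hab : a * m.leadingCoeff h = b * m.leadingCoeff h') {u : Fin n →₀ ℕ}
    (hu : (a • h - b • h').coeff u ≠ 0) : u ∉ L.cone (leadingMonomials m F) := by
  have hne : u ≠ m.degree h := by
    rintro rfl
    apply hu
    rw [coeff_sub, coeff_smul, coeff_smul, smul_eq_mul, smul_eq_mul]
    nth_rewrite 2 [hdeg]
    exact sub_eq_zero.2 hab
  by_cases h1 : h.coeff u = 0
  · have h2 : h'.coeff u ≠ 0 := fun h2 => hu (by simp [h1, h2])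
    exact hF.2 h' hh' u (mem_support_iff.2 h2) (hdeg ▸ hne)
  · exact hF.2 h hh u (mem_support_iff.2 h1) hne

/-! ### Reductions and the existence of normal forms -/

lemma exists_reduces_of_mem_cone {p : MvPolynomial (Fin n) K} {u : Fin n →₀ ℕ}
    (hp : p.coeff u ≠ 0) (hu : u ∈ L.cone (leadingMonomials m F)) : ∃ q, L.Reduces m F p q := by
  obtain ⟨f, hf, v, rfl, hdvd⟩ := exists_mem_of_mem_cone hu
  exact ⟨_, f, hf, v, hp, hdvd, rfl⟩

lemma coeff_mem_cone_of_reduces {p q : MvPolynomial (Fin n) K} (h : L.Reduces m F p q) :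
    ∃ u ∈ L.cone (leadingMonomials m F), p.coeff u ≠ 0 := by
  obtain ⟨f, hf, v, hp, hdvd, -⟩ := h
  exact ⟨_, ⟨_, degree_mem_leadingMonomials hf, hdvd⟩, hp⟩

/-- Reducing the largest reducible monomial first terminates, so normal forms exist. -/
lemma exists_isNormalForm (hF0 : 0 ∉ F) (p : MvPolynomial (Fin n) K) :
    ∃ h, L.IsNormalForm m F p h := by
  classical
  let S : MvPolynomial (Fin n) K → Finset (Fin n →₀ ℕ) := fun p =>
    p.support.filter (· ∈ L.cone (leadingMonomials m F))
  let μ : MvPolynomial (Fin n) K → WithBot m.syn := fun p =>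
    (S p).sup fun u => (m.toSyn u : WithBot m.syn)
  induction h : μ p using WellFoundedLT.induction generalizing p with
  | ind d ih =>
    subst h
    rcases (S p).eq_empty_or_nonempty with h0 | hne
    · refine ⟨p, .refl, fun q hq => ?_⟩
      obtain ⟨u, hu, hpu⟩ := coeff_mem_cone_of_reduces hq
      have : u ∈ S p := Finset.mem_filter.2 ⟨mem_support_iff.2 hpu, hu⟩
      simp [h0] at this
    · obtain ⟨u, hu, hmax⟩ := Finset.exists_max_image (S p) m.toSyn hne
      obtain ⟨hup, huc⟩ := Finset.mem_filter.1 hu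
      rw [mem_support_iff] at hup
      obtain ⟨f, hf, v, rfl, hdvd⟩ := exists_mem_of_mem_cone huc
      set q := p - monomial v (p.coeff (m.degree f + v) / m.leadingCoeff f) * f with hq
      have hred : L.Reduces m F p q := ⟨f, hf, v, hup, hdvd, rfl⟩
      have hlt : μ q < μ p := by
        refine lt_of_lt_of_le ?_ (Finset.le_sup (f := fun u => (m.toSyn u : WithBot m.syn)) hu)
        rw [Finset.sup_lt_iff (WithBot.bot_lt_coe _)]
        intro b hb
        obtain ⟨hbq, hbc⟩ := Finset.mem_filter.1 hb
        rw [mem_support_iff] at hbq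
        rw [WithBot.coe_lt_coe]
        by_contra hcon
        rcases (not_lt.1 hcon).eq_or_lt with heq | hgt
        · rw [← m.toSyn.injective heq, hq, coeff_sub, coeff_monomial_mul_degree,
            div_mul_cancel₀ _ (leadingCoeff_ne_zero_of_mem hF0 hf), sub_self] at hbq
          exact hbq rfl
        · rw [hq, coeff_sub, coeff_monomial_mul_of_lt _ hgt, sub_zero] at hbq
          exact not_le.2 hgt (hmax b (Finset.mem_filter.2 ⟨mem_support_iff.2 hbq, hbc⟩))
      obtain ⟨r, hr, hr'⟩ := ih _ hlt q rfl
      exact ⟨r, .head hred hr, hr'⟩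

lemma NormalFormEq.of_reduces (hF0 : 0 ∉ F) {p q : MvPolynomial (Fin n) K}
    (hp : L.NormalFormEq m F p 0) (hpq : L.Reduces m F p q) : L.NormalFormEq m F q 0 := by
  have huniq : ∀ h, L.IsNormalForm m F q h → h = 0 := fun h hh =>
    hp.2 h ⟨.head hpq hh.1, hh.2⟩
  obtain ⟨h, hh⟩ := exists_isNormalForm (L := L) (m := m) hF0 q
  exact ⟨huniq h hh ▸ hh, huniq⟩

/-! ### Multiplicative spans -/

lemma multiplicativeSpan_mono {P Q : Set (Fin n →₀ ℕ)} (h : P ⊆ Q) :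
    multiplicativeSpan L m F P ≤ multiplicativeSpan L m F Q := by
  apply Submodule.span_mono
  rintro p ⟨f, hf, v, hd, hP, rfl⟩
  exact ⟨f, hf, v, hd, h hP, rfl⟩

lemma Reduces.sub_mem {p q : MvPolynomial (Fin n) K} (h : L.Reduces m F p q) :
    p - q ∈ multiplicativeSpan L m F {u | u ≼[m] m.degree p} := by
  obtain ⟨f, hf, v, hp, hdvd, rfl⟩ := h
  rw [sub_sub_cancel, monomial_mul_eq_smul]
  exact Submodule.smul_mem _ _ (Submodule.subset_span
    ⟨f, hf, v, hdvd, m.le_degree (mem_support_iff.2 hp), rfl⟩)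

lemma Reduces.degree_le {p q : MvPolynomial (Fin n) K} (h : L.Reduces m F p q) :
    m.degree q ≼[m] m.degree p := by
  obtain ⟨f, hf, v, hp, hdvd, rfl⟩ := h
  rw [m.degree_le_iff]
  intro b hb
  by_contra hcon
  rw [not_le] at hcon
  apply mem_support_iff.1 hb
  rw [coeff_sub, m.coeff_eq_zero_of_lt hcon, coeff_monomial_mul_of_lt, sub_zero]
  exact (m.le_degree (mem_support_iff.2 hp)).trans_lt hcon

lemma sub_mem_of_reflTransGen {p q : MvPolynomial (Fin n) K}
    (h : Relation.ReflTransGen (L.Reduces m F) p q) :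
    p - q ∈ multiplicativeSpan L m F {u | u ≼[m] m.degree p} := by
  induction h using Relation.ReflTransGen.head_induction_on with
  | refl => simp
  | @head a b hab _ ih =>
    have := Submodule.add_mem _ hab.sub_mem
      (multiplicativeSpan_mono (fun u (hu : u ≼[m] _) => le_trans hu hab.degree_le) ih)
    simpa using this

lemma NormalFormEq.mem_multiplicativeSpan {p : MvPolynomial (Fin n) K}
    (hp : L.NormalFormEq m F p 0) : p ∈ multiplicativeSpan L m F {u | u ≼[m] m.degree p} := by
  simpa using sub_mem_of_reflTransGen hp.1.1

/-- A normal form zero persists when the head of a polynomial is cancelled by a multiplicative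
product, and leaves a representation with smaller leading monomials. -/
lemma NormalFormEq.sub_mem_of_head (hF0 : 0 ∉ F) {p h : MvPolynomial (Fin n) K}
    (hp : L.NormalFormEq m F p 0) (hh : h ∈ F) {v : Fin n →₀ ℕ} (hv : m.degree h + v = m.degree p)
    (hdvd : L.dvd (leadingMonomials m F) (m.degree h) (m.degree h + v)) (hp0 : p ≠ 0) :
    p - monomial v (m.leadingCoeff p / m.leadingCoeff h) * h ∈
      multiplicativeSpan L m F {u | u ≺[m] m.degree p} := by
  set q := p - monomial v (m.leadingCoeff p / m.leadingCoeff h) * h with hq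
  have hred : L.Reduces m F p q := by
    refine ⟨h, hh, v, ?_, hdvd, ?_⟩
    · rw [hv]; exact m.leadingCoeff_ne_zero_iff.2 hp0
    · rw [hv]; rfl
  by_cases hq0 : q = 0
  · rw [hq0]; exact zero_mem _
  refine multiplicativeSpan_mono ?_ (hp.of_reduces hF0 hred).mem_multiplicativeSpan
  intro u (hu : u ≼[m] m.degree q)
  refine hu.trans_lt (lt_of_le_of_ne hred.degree_le fun heq => ?_)
  have hc : q.coeff (m.degree q) ≠ 0 := m.coeff_degree_ne_zero_iff.2 hq0
  rw [m.toSyn.injective heq, hq, coeff_sub, ← hv, coeff_monomial_mul_degree,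
    div_mul_cancel₀ _ (leadingCoeff_ne_zero_of_mem hF0 hh), hv] at hc
  exact hc (sub_self _)

/-- Under proportionality the multiplicative products have, up to scalars, pairwise distinct
leading monomials, so that the largest one occurring in a combination cannot cancel. -/
lemma degree_mem_cone_of_mem_multiplicativeSpan (hF0 : 0 ∉ F) (hF : L.Autoreduced m F)
    {P : Set (Fin n →₀ ℕ)} (hP : ∀ u ∈ P, ∀ u', u' ≼[m] u → u' ∈ P) (hprop : ProportionalOn m F P)
    {p : MvPolynomial (Fin n) K} (hp : p ∈ multiplicativeSpan L m F P) (hp0 : p ≠ 0) :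
    m.degree p ∈ L.cone (leadingMonomials m F) := by
  -- one representative `e u` for each monomial `u` of the cone
  have hex : ∀ u, ∃ e : MvPolynomial (Fin n) K, u ∈ L.cone (leadingMonomials m F) ∩ P →
      e.coeff u ≠ 0 ∧ (∀ u', u ≺[m] u' → e.coeff u' = 0) ∧
      ∀ h ∈ F, ∀ v, m.degree h + v = u →
        L.dvd (leadingMonomials m F) (m.degree h) (m.degree h + v) →
        ∃ c : K, monomial v 1 * h = c • e := by
    intro u
    by_cases hu : u ∈ L.cone (leadingMonomials m F) ∩ P
    · obtain ⟨f, hf, v, rfl, hdvd⟩ := exists_mem_of_mem_cone hu.1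
      have hlc := leadingCoeff_ne_zero_of_mem (m := m) hF0 hf
      refine ⟨monomial v 1 * f, fun _ => ⟨?_, fun u' hu' => coeff_monomial_mul_of_lt 1 hu', ?_⟩⟩
      · rwa [coeff_monomial_mul_degree, one_mul]
      · intro h hh v' hv' hdvd'
        have hdeg : m.degree h = m.degree f := degree_eq_of_dvd hF hh hf (hv' ▸ hdvd') hdvd
        obtain rfl : v' = v := add_left_cancel (hdeg ▸ hv')
        have hPh : m.degree h ∈ P := hP _ hu.2 _ (by rw [← hv']; exact m.toSyn_monotone le_self_add)
        refine ⟨m.leadingCoeff h / m.leadingCoeff f, ?_⟩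
        rw [← mul_smul_comm, div_eq_inv_mul, mul_smul, ← hprop h hh f hf hdeg hPh, smul_smul,
          inv_mul_cancel₀ hlc, one_smul]
    · exact ⟨0, fun h => (hu h).elim⟩
  choose e he using hex
  have hle : multiplicativeSpan L m F P ≤
      Submodule.span K (e '' (L.cone (leadingMonomials m F) ∩ P)) := by
    refine Submodule.span_le.2 ?_
    rintro q ⟨h, hh, v, hdvd, hvP, rfl⟩
    have hu : m.degree h + v ∈ L.cone (leadingMonomials m F) ∩ P :=
      ⟨⟨_, degree_mem_leadingMonomials hh, hdvd⟩, hvP⟩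
    obtain ⟨c, hc⟩ := (he _ hu).2.2 h hh v rfl hdvd
    rw [hc]
    exact Submodule.smul_mem _ _ (Submodule.subset_span ⟨_, hu, rfl⟩)
  obtain ⟨l, hl, rfl⟩ := (Finsupp.mem_span_image_iff_linearCombination K).1 (hle hp)
  rw [Finsupp.mem_supported] at hl
  have hne : l.support.Nonempty := by
    rw [Finsupp.support_nonempty_iff]
    rintro rfl
    exact hp0 (map_zero _)
  obtain ⟨u, hu, hmax⟩ := Finset.exists_max_image l.support m.toSyn hne
  have hcoeff : ∀ b, (Finsupp.linearCombination K e l).coeff b =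
      ∑ a ∈ l.support, l a * (e a).coeff b := by
    intro b
    rw [Finsupp.linearCombination_apply, Finsupp.sum, coeff_sum]
    simp only [coeff_smul, smul_eq_mul]
  have hdeg : m.degree (Finsupp.linearCombination K e l) = u := by
    apply degree_eq_of_coeff
    · rw [hcoeff, Finset.sum_eq_single_of_mem u hu]
      · exact mul_ne_zero (Finsupp.mem_support_iff.1 hu) (he u (hl hu)).1
      · intro b hb hbu
        rw [(he b (hl hb)).2.1 u (lt_of_le_of_ne (hmax b hb) (m.toSyn.injective.ne hbu)), mul_zero]
    · intro u' hu'
      rw [hcoeff]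
      refine Finset.sum_eq_zero fun b hb => ?_
      rw [(he b (hl hb)).2.1 u' ((hmax b hb).trans_lt hu'), mul_zero]
  rw [hdeg]
  exact (hl hu).1

/-- Membership in a multiplicative span suffices for normal form zero: reductions keep an element
of `multiplicativeSpan L m F P` inside it, and an irreducible element of it vanishes. -/
lemma normalFormEq_zero_of_mem_multiplicativeSpan (hF0 : 0 ∉ F) (hF : L.Autoreduced m F)
    {P : Set (Fin n →₀ ℕ)} (hP : ∀ u ∈ P, ∀ u', u' ≼[m] u → u' ∈ P) (hprop : ProportionalOn m F P)
    {p : MvPolynomial (Fin n) K} (hp : p ∈ multiplicativeSpan L m F P) (hpP : m.degree p ∈ P) :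
    L.NormalFormEq m F p 0 := by
  have huniq : ∀ h, L.IsNormalForm m F p h → h = 0 := by
    intro h hh
    by_contra h0
    have h1 : h ∈ multiplicativeSpan L m F P := by
      have := Submodule.sub_mem _ hp
        (multiplicativeSpan_mono (fun u hu => hP _ hpP u hu) (sub_mem_of_reflTransGen hh.1))
      simpa using this
    obtain ⟨q, hq⟩ := exists_reduces_of_mem_cone (m.coeff_degree_ne_zero_iff.2 h0)
      (degree_mem_cone_of_mem_multiplicativeSpan hF0 hF hP hprop h1 h0)
    exact hh.2 q hq
  obtain ⟨h, hh⟩ := exists_isNormalForm (L := L) (m := m) hF0 p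
  exact ⟨huniq h hh ▸ hh, huniq⟩

/-! ### Products below a monomial -/

lemma monomial_mul_mem_productSpan {d s w : Fin n →₀ ℕ} (hds : d + s = w)
    {p : MvPolynomial (Fin n) K} (hp : p ∈ multiplicativeSpan L m F {u | u ≺[m] d}) (c : K) :
    monomial s c * p ∈ productSpan m F {u | u ≺[m] w} := by
  induction hp using Submodule.span_induction with
  | mem p hp =>
    obtain ⟨h, hh, v, -, hv, rfl⟩ := hp
    rw [← mul_assoc, monomial_mul, mul_one, monomial_mul_eq_smul]
    refine Submodule.smul_mem _ _ (Submodule.subset_span ⟨h, hh, s + v, ?_, rfl⟩)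
    have : m.degree h + (s + v) = m.degree h + v + s := by abel
    rw [Set.mem_ofPred_eq, this, ← hds, map_add, map_add m.toSyn d]
    exact add_lt_add_left hv _
  | zero => simp
  | add p q _ _ hp hq => rw [mul_add]; exact add_mem hp hq
  | smul a p _ hp => rw [mul_smul_comm]; exact Submodule.smul_mem _ _ hp

/-- If all products below `w` have normal form zero, non-multiplicative products below `w` are
combinations of multiplicative ones. -/
lemma productSpan_le_multiplicativeSpan (hF0 : 0 ∉ F) {w : Fin n →₀ ℕ}
    (hpart : ∀ h ∈ F, ∀ u : Fin n →₀ ℕ, m.degree h + u ≺[m] w →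
      L.NormalFormEq m F (h * monomial u 1) 0) :
    productSpan m F {u | u ≺[m] w} ≤ multiplicativeSpan L m F {u | u ≺[m] w} := by
  refine Submodule.span_le.2 ?_
  rintro p ⟨h, hh, u, hu, rfl⟩
  have h1 := hpart h hh u hu
  rw [mul_comm] at h1
  refine multiplicativeSpan_mono ?_ h1.mem_multiplicativeSpan
  intro b hb
  rw [Set.mem_ofPred_eq, degree_monomial_mul hF0 hh u one_ne_zero] at hb
  exact lt_of_le_of_lt hb hu

/-- If `h ∈ F` has normal form zero, any `h' ∈ F` with the same leading monomial is proportional to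
it, since reducing `h` by `h'` ends after one step. -/
lemma proportionalOn_of_partial (hF0 : 0 ∉ F) (hF : L.Autoreduced m F) {w : Fin n →₀ ℕ}
    (hpart : ∀ h ∈ F, ∀ u : Fin n →₀ ℕ, m.degree h + u ≺[m] w →
      L.NormalFormEq m F (h * monomial u 1) 0) :
    ProportionalOn m F {u | u ≺[m] w} := by
  intro h hh h' hh' hdeg hw
  have h1 := hpart h hh 0 (by simpa using hw)
  rw [← C_apply, C_1, mul_one] at h1
  have hlc := leadingCoeff_ne_zero_of_mem (m := m) hF0 hh
  have hlc' := leadingCoeff_ne_zero_of_mem (m := m) hF0 hh'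
  -- reducing `h` by `h'` leaves only tails, an irreducible polynomial
  have hred : L.Reduces m F h ((1 : K) • h - (m.leadingCoeff h / m.leadingCoeff h') • h') := by
    refine ⟨h', hh', 0, ?_, ?_, ?_⟩
    · rw [add_zero, ← hdeg]; exact hlc
    · rw [add_zero]; exact L.dvd_self _ _ (degree_mem_leadingMonomials hh')
    · rw [add_zero, ← hdeg, one_smul, smul_eq_C_mul, C_apply]; rfl
  have hzero := h1.2 _ ⟨.single hred, fun q hq => by
    obtain ⟨u, hu, hne⟩ := coeff_mem_cone_of_reduces hq
    refine notMem_cone_of_cancel hF hh hh' hdeg ?_ hne hu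
    rw [one_mul, div_mul_cancel₀ _ hlc']⟩
  rw [one_smul, sub_eq_zero] at hzero
  nth_rewrite 1 [hzero]
  rw [smul_smul, mul_div_cancel₀ _ hlc']

/-- Proportionality extends from the monomials below `w` to `w` itself, once some polynomial with
leading monomial `w` has normal form zero: reducing it by either of two candidates gives elements
of the same multiplicative span, whose difference is a combination of tails. -/
lemma proportionalOn_le_of_normalFormEq (hF0 : 0 ∉ F) (hF : L.Autoreduced m F) {w : Fin n →₀ ℕ}
    (hprop : ProportionalOn m F {u | u ≺[m] w})
    (hw : w ∈ leadingMonomials m F → ∃ p : MvPolynomial (Fin n) K,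
      p ≠ 0 ∧ m.degree p = w ∧ L.NormalFormEq m F p 0) :
    ProportionalOn m F {u | u ≼[m] w} := by
  intro h hh h' hh' hdeg hle
  rcases (show m.degree h ≼[m] w from hle).lt_or_eq with hlt | heq
  · exact hprop h hh h' hh' hdeg hlt
  have hhw := m.toSyn.injective heq
  obtain ⟨p, hp0, hpw, hp⟩ := hw (hhw ▸ degree_mem_leadingMonomials hh)
  have hlc := leadingCoeff_ne_zero_of_mem (m := m) hF0 hh
  have hlc' := leadingCoeff_ne_zero_of_mem (m := m) hF0 hh'
  have hlcp := m.leadingCoeff_ne_zero_iff.2 hp0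
  have key : ∀ f ∈ F, m.degree f = w → p - (m.leadingCoeff p / m.leadingCoeff f) • f ∈
      multiplicativeSpan L m F {u | u ≺[m] w} := by
    intro f hf hfw
    have := hp.sub_mem_of_head hF0 hf (v := 0) (by rw [add_zero, hfw, hpw])
      (by rw [add_zero]; exact L.dvd_self _ _ (degree_mem_leadingMonomials hf)) hp0
    rwa [hpw, ← C_apply, ← smul_eq_C_mul] at this
  have hmem := sub_mem (key h' hh' (hdeg ▸ hhw)) (key h hh hhw)
  rw [sub_sub_sub_cancel_left] at hmem
  have hzero : (m.leadingCoeff p / m.leadingCoeff h) • h -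
      (m.leadingCoeff p / m.leadingCoeff h') • h' = 0 := by
    by_contra hne
    refine notMem_cone_of_cancel hF hh hh' hdeg ?_ (m.coeff_degree_ne_zero_iff.2 hne)
      (degree_mem_cone_of_mem_multiplicativeSpan hF0 hF
        (fun u hu u' hu' => lt_of_le_of_lt hu' hu) hprop hmem hne)
    rw [div_mul_cancel₀ _ hlc, div_mul_cancel₀ _ hlc']
  rw [sub_eq_zero] at hzero
  have h2 := congrArg (fun q => (m.leadingCoeff h * m.leadingCoeff h' / m.leadingCoeff p) • q) hzero
  simp only [smul_smul] at h2
  convert h2 using 2 <;> field_simp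

/-- If `f₀ * lt(f)/lt(f₀)` has normal form zero, then modulo products below `lm(f) * x^v = w` the
product `f * x^v` may be replaced by a multiple of `f₀`. -/
lemma sub_mem_productSpan_of_quotient (hF0 : 0 ∉ F) {f f₀ : MvPolynomial (Fin n) K} (hf : f ∈ F)
    (hf₀ : f₀ ∈ F) (hle : m.degree f₀ ≤ m.degree f)
    (hNF : L.NormalFormEq m F (f₀ * monomial (m.degree f - m.degree f₀)
      (m.leadingCoeff f / m.leadingCoeff f₀)) 0) {v w : Fin n →₀ ℕ} (hv : m.degree f + v = w) :
    monomial (w - m.degree f₀) (m.leadingCoeff f₀)⁻¹ * f₀ - monomial v (m.leadingCoeff f)⁻¹ * f ∈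
      productSpan m F {u | u ≺[m] w} := by
  have hlf := leadingCoeff_ne_zero_of_mem (m := m) hF0 hf
  have hlf₀ := leadingCoeff_ne_zero_of_mem (m := m) hF0 hf₀
  rw [mul_comm] at hNF
  have hdeg : m.degree (monomial (m.degree f - m.degree f₀)
      (m.leadingCoeff f / m.leadingCoeff f₀) * f₀) = m.degree f := by
    rw [degree_monomial_mul hF0 hf₀ _ (div_ne_zero hlf hlf₀), add_tsub_cancel_of_le hle]
  have hlc : m.leadingCoeff (monomial (m.degree f - m.degree f₀)
      (m.leadingCoeff f / m.leadingCoeff f₀) * f₀) = m.leadingCoeff f := by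
    rw [MonomialOrder.leadingCoeff, hdeg]
    nth_rewrite 1 [← add_tsub_cancel_of_le hle]
    rw [coeff_monomial_mul_degree, div_mul_cancel₀ _ hlf₀]
  have hne : monomial (m.degree f - m.degree f₀)
      (m.leadingCoeff f / m.leadingCoeff f₀) * f₀ ≠ 0 := by
    rw [← m.leadingCoeff_ne_zero_iff, hlc]; exact hlf
  have h1 := hNF.sub_mem_of_head hF0 hf (v := 0) (by rw [add_zero, hdeg])
      (by rw [add_zero]; exact L.dvd_self _ _ (degree_mem_leadingMonomials hf)) hne
  rw [hlc, hdeg, div_self hlf, ← C_apply, C_1, one_mul] at h1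
  have h2 := monomial_mul_mem_productSpan hv h1 (m.leadingCoeff f)⁻¹
  rw [mul_sub, ← mul_assoc, monomial_mul] at h2
  convert h2 using 4
  · rw [← hv, add_comm v, tsub_add_eq_add_tsub hle]
  · field_simp

/-- If `f₀ * x^a` has normal form zero and leading monomial `d` dividing `w`, then modulo products
below `w` the monic multiple of `f₀` with leading monomial `w` may be replaced by that of the
element `h` which divides `d` involutively. -/
lemma sub_mem_productSpan_of_lcm (hF0 : 0 ∉ F) {f₀ h : MvPolynomial (Fin n) K} (hf₀ : f₀ ∈ F)
    (hh : h ∈ F) {d v w : Fin n →₀ ℕ} (hfd : m.degree f₀ ≤ d) (hdw : d ≤ w)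
    (hNF : L.NormalFormEq m F (f₀ * monomial (d - m.degree f₀) 1) 0) (hv : m.degree h + v = d)
    (hdvd : L.dvd (leadingMonomials m F) (m.degree h) (m.degree h + v)) :
    monomial (w - m.degree f₀) (m.leadingCoeff f₀)⁻¹ * f₀ -
      monomial (w - d + v) (m.leadingCoeff h)⁻¹ * h ∈ productSpan m F {u | u ≺[m] w} := by
  have hlf₀ := leadingCoeff_ne_zero_of_mem (m := m) hF0 hf₀
  rw [mul_comm] at hNF
  have hdeg : m.degree (monomial (d - m.degree f₀) 1 * f₀) = d := by
    rw [degree_monomial_mul hF0 hf₀ _ one_ne_zero, add_tsub_cancel_of_le hfd]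
  have hlc : m.leadingCoeff (monomial (d - m.degree f₀) 1 * f₀) = m.leadingCoeff f₀ := by
    rw [MonomialOrder.leadingCoeff, hdeg]
    nth_rewrite 1 [← add_tsub_cancel_of_le hfd]
    rw [coeff_monomial_mul_degree, one_mul]
  have hne : monomial (d - m.degree f₀) 1 * f₀ ≠ 0 := by
    rw [← m.leadingCoeff_ne_zero_iff, hlc]; exact hlf₀
  have h1 := hNF.sub_mem_of_head hF0 hh (v := v) (by rw [hv, hdeg]) hdvd hne
  rw [hlc, hdeg] at h1
  have h2 := monomial_mul_mem_productSpan (add_tsub_cancel_of_le hdw) h1 (m.leadingCoeff f₀)⁻¹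
  rw [mul_sub, ← mul_assoc, ← mul_assoc, monomial_mul, monomial_mul] at h2
  convert h2 using 4
  · rw [tsub_add_tsub_cancel hdw hfd]
  · rw [mul_one]
  · field_simp

end Auxiliary

end InvolutiveDivision

/-! ### The involutive chain criterion -/

open MvPolynomial InvolutiveDivision in
theorem mainTheorem5 {K : Type*} [Field K] {n : ℕ} (m : MonomialOrder (Fin n))
    (L : InvolutiveDivision n) (F : Finset (MvPolynomial (Fin n) K)) (hF0 : 0 ∉ F)
    (hF : L.Autoreduced m F)
    (g : MvPolynomial (Fin n) K) (hg : g ∈ F) (i : Fin n)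
    (hi : ¬ L.IsMultiplicative (InvolutiveDivision.leadingMonomials m F) (m.degree g) i)
    (hpart : ∀ h ∈ F, ∀ u : Fin n →₀ ℕ,
      m.degree h + u ≺[m] m.degree g + Finsupp.single i 1 →
        L.NormalFormEq m F (h * MvPolynomial.monomial u 1) 0)
    (hcrit : ∃ f ∈ F, ∃ f₀ ∈ F, ∃ g₀ ∈ F,
      m.degree f₀ ≤ m.degree f ∧ m.degree g₀ ≤ m.degree g ∧
      L.dvd (InvolutiveDivision.leadingMonomials m F) (m.degree f)
        (m.degree g + Finsupp.single i 1) ∧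
      m.degree f₀ ⊔ m.degree g₀ ≺[m] m.degree g + Finsupp.single i 1 ∧
      L.NormalFormEq m F (f₀ * MvPolynomial.monomial (m.degree f - m.degree f₀)
        (m.leadingCoeff f / m.leadingCoeff f₀)) 0 ∧
      L.NormalFormEq m F (g₀ * MvPolynomial.monomial (m.degree g - m.degree g₀)
        (m.leadingCoeff g / m.leadingCoeff g₀)) 0) :
    L.NormalFormEq m F (g * MvPolynomial.X i) 0 := by
  obtain ⟨f, hf, f₀, hf₀, g₀, hg₀, hf₀f, hg₀g, hfw, hlcm, hNFf, hNFg⟩ := hcrit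
  set w := m.degree g + Finsupp.single i 1 with hw
  have hlg := leadingCoeff_ne_zero_of_mem (m := m) hF0 hg
  have hfle : m.degree f ≤ w := L.le_of_dvd _ _ (degree_mem_leadingMonomials hf) _ hfw
  have hv : m.degree f + (w - m.degree f) = w := add_tsub_cancel_of_le hfle
  set v := w - m.degree f
  have hlow := productSpan_le_multiplicativeSpan hF0 hpart
  have hproplt := proportionalOn_of_partial hF0 hF hpart
  have hprop : ProportionalOn m F {u | u ≼[m] w} := by
    refine proportionalOn_le_of_normalFormEq hF0 hF hproplt fun hwF => ?_
    -- `w = lm(f)` here, and `f₀ * lt(f)/lt(f₀)` is the required polynomial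
    have hdf : m.degree f = w := hF.1 _ (degree_mem_leadingMonomials hf) _ hwF hfw
    have hc := div_ne_zero (leadingCoeff_ne_zero_of_mem (m := m) hF0 hf)
      (leadingCoeff_ne_zero_of_mem (m := m) hF0 hf₀)
    refine ⟨_, ?_, ?_, hNFf⟩
    · exact mul_ne_zero (fun h => hF0 (h ▸ hf₀)) (mt monomial_eq_zero.1 hc)
    · rw [mul_comm, degree_monomial_mul hF0 hf₀ _ hc, add_tsub_cancel_of_le hf₀f, hdf]
  set d := m.degree f₀ ⊔ m.degree g₀
  have hfd : m.degree f₀ ≤ d := le_sup_left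
  have hgd : m.degree g₀ ≤ d := le_sup_right
  have hdw : d ≤ w := sup_le (hf₀f.trans hfle) (hg₀g.trans le_self_add)
  have hNF₁ := hpart f₀ hf₀ (d - m.degree f₀) (by rwa [add_tsub_cancel_of_le hfd])
  have hNF₂ := hpart g₀ hg₀ (d - m.degree g₀) (by rwa [add_tsub_cancel_of_le hgd])
  have hdcone : d ∈ L.cone (leadingMonomials m F) := by
    have hdeg : m.degree (f₀ * monomial (d - m.degree f₀) 1) = d := by
      rw [mul_comm, degree_monomial_mul hF0 hf₀ _ one_ne_zero, add_tsub_cancel_of_le hfd]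
    have hmem := hNF₁.mem_multiplicativeSpan
    rw [hdeg] at hmem
    have := degree_mem_cone_of_mem_multiplicativeSpan hF0 hF
      (fun u hu u' hu' => lt_of_le_of_lt hu' hu) hproplt
      (multiplicativeSpan_mono (fun u hu => lt_of_le_of_lt hu hlcm) hmem)
      (mul_ne_zero (fun h => hF0 (h ▸ hf₀)) (mt monomial_eq_zero.1 one_ne_zero))
    rwa [hdeg] at this
  obtain ⟨h, hh, z, hz, hzdvd⟩ := exists_mem_of_mem_cone hdcone
  -- modulo products below `w`: `f x^v ≡ f₀ x^(w - lm f₀) ≡ h x^(w - d + z) ≡ g₀ x^(w - lm g₀) ≡ g x`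
  -- after normalizing the leading coefficients
  have e₁ := sub_mem_productSpan_of_quotient hF0 hf hf₀ hf₀f hNFf hv
  have e₂ := sub_mem_productSpan_of_lcm hF0 hf₀ hh hfd hdw hNF₁ hz hzdvd
  have e₃ := sub_mem_productSpan_of_lcm hF0 hg₀ hh hgd hdw hNF₂ hz hzdvd
  have e₄ := sub_mem_productSpan_of_quotient hF0 hg hg₀ hg₀g hNFg hw.symm
  have e₅ : monomial (Finsupp.single i 1) (m.leadingCoeff g)⁻¹ * g -
      monomial v (m.leadingCoeff f)⁻¹ * f ∈ productSpan m F {u | u ≺[m] w} := by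
    convert sub_mem (add_mem e₃ e₁) (add_mem e₂ e₄) using 1
    ring
  have e₆ : monomial (Finsupp.single i 1) (m.leadingCoeff g)⁻¹ * g ∈
      multiplicativeSpan L m F {u | u ≼[m] w} := by
    rw [← sub_add_cancel (monomial (Finsupp.single i 1) (m.leadingCoeff g)⁻¹ * g)
      (monomial v (m.leadingCoeff f)⁻¹ * f)]
    refine add_mem (multiplicativeSpan_mono (fun u hu => le_of_lt hu) (hlow e₅)) ?_
    rw [monomial_mul_eq_smul]
    exact Submodule.smul_mem _ _ (Submodule.subset_span ⟨f, hf, v, by rwa [hv], by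
      rw [hv]; exact le_refl (m.toSyn w), rfl⟩)
  rw [monomial_mul_eq_smul, Submodule.smul_mem_iff _ (inv_ne_zero hlg)] at e₆
  have hgX : g * X i = monomial (Finsupp.single i 1) 1 * g := mul_comm _ _
  rw [hgX]
  refine normalFormEq_zero_of_mem_multiplicativeSpan hF0 hF
    (fun u hu u' hu' => le_trans hu' hu) hprop e₆ ?_
  rw [degree_monomial_mul hF0 hg _ one_ne_zero]
  exact le_refl (m.toSyn w)
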